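/- Let $d\ge 1$ and let $|\rho\rangle\in\mathbb C^d\otimes\mathbb C^d$ be an entangled unit vector (i.e. not a product vector), with Schmidt decomposition $|\rho\rangle=\sum_{i=0}^{d-1}\sqrt{\lambda_i}\,|e_i\rangle\otimes|f_i\rangle$, where $(e_i)$, $(f_i)$ are orthonormal bases, $\lambda_0\ge\lambda_1\ge\dots\ge\lambda_{d-1}\ge 0$ and $\sum_i\lambda_i=1$. Put $\rho=|\rho\rangle\langle\rho|$ and $\lambda=\lambda_0$, and let $\theta\in[0,1]$. For a bipartite system and a class $X$ of two-outcome measurements $\{T,I-T\}$, define for a state $\tau$ the minimax error probability $$P^X_{err}(\tau;\theta)=\inf_{\{T,I-T\}\in X}\ \sup_{\sigma}\ \tfrac12\,\mathrm{Tr}\big((I-T)\tau+T\sigma\big),$$ the supremum being over all states $\sigma$ with $\mathrm{Tr}\,\tau\sigma\le\theta$, and define $$\xi^X(\rho;\theta)=\lim_{n\to\infty}-\frac1n\log P^X_{err}(\rho^{\otimes n};\theta^n)\in[0,\infty],$$ where $-\log 0=+\infty$, and $\rho^{\otimes n}$ is a bipartite state with Alice holding all the first tensor factors and Bob all the second ones.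 The classes are: $LOCC^1$ (local operations and classical communication from Alice to Bob only), $LOCC$ (local operations and finitely many rounds of two-way classical communication), $SEP$ ($T$ and $I-T$ are both finite sums of products of positive semidefinite operators), $PPT$ ($T$, $I-T$ and their partial transposes are positive semidefinite), and $ALL$ ($0\le T\le I$). Then the limit $\xi^X(\rho;\theta)$ exists for each of the five classes $X$, and $$\xi^{LOCC^1}(\rho;\theta)=\xi^{LOCC}(\rho;\theta)=\xi^{SEP}(\rho;\theta)=\xi^{PPT}(\rho;\theta)=-\log\max(\theta,\lambda).$$ Moreover: - If $\theta\ge\lambda$, then $\xi^{LOCC^1}(\rho;\theta)=-\log\theta=\xi^{ALL}(\rho;\theta)$. - If $\theta<\lambda<1$, then $\xi^{PPT}(\rho;\theta)<\xi^{ALL}(\rho;\theta)$. - In particular, if $\theta<\frac1d$, then $\xi^{PPT}(\rho;\theta)<\xi^{ALL}(\rho;\theta)$ and $\xi^{LOCC}(\rho;\theta)<\xi^{ALL}(\rho;\theta)$. -/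

import Mathlib

open Matrix Filter Topology
open scoped Kronecker ENNReal ComplexOrder

namespace PureStateTest

/-- A (mixed) state: positive semidefinite with trace one. -/
def IsState {γ : Type} [Fintype γ] (σ : Matrix γ γ ℂ) : Prop :=
  σ.PosSemidef ∧ σ.trace = 1

/-- The operator `|ψ⟩⟨ψ|`. -/
def pureState {γ : Type} (ψ : γ → ℂ) : Matrix γ γ ℂ :=
  Matrix.vecMulVec ψ (star ψ)

/-- A bipartite vector that is not a product vector `a ⊗ b`. -/
def IsEntangled {α β : Type} (ψ : α × β → ℂ) : Prop :=
  ¬ ∃ (a : α → ℂ) (b : β → ℂ), ∀ p : α × β, ψ p = a p.1 * b p.2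

/-- `ψ = ∑ i, √(lam i) • e i ⊗ f i` is a Schmidt decomposition of `ψ`, with the coefficients
`lam i` in nonincreasing order. -/
structure IsSchmidtDecomposition {d : ℕ} (ψ : Fin d × Fin d → ℂ) (lam : Fin d → ℝ)
    (e f : OrthonormalBasis (Fin d) ℂ (EuclideanSpace ℂ (Fin d))) : Prop where
  antitone : Antitone lam
  nonneg : ∀ i, 0 ≤ lam i
  eq_sum : ∀ p : Fin d × Fin d, ψ p = ∑ i, (Real.sqrt (lam i) : ℂ) * (e i p.1 * f i p.2)

/-- Every bipartite vector has a Schmidt decomposition. -/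
theorem exists_isSchmidtDecomposition {d : ℕ} (ψ : Fin d × Fin d → ℂ) :
    ∃ lam e f, IsSchmidtDecomposition ψ lam e f := by
  let M : Matrix (Fin d) (Fin d) ℂ := Matrix.of fun i j => ψ (i, j)
  let L := Matrix.toEuclideanLin Mᴴ
  have hT : (LinearMap.adjoint L * L).IsSymmetric := LinearMap.isSymmetric_adjoint_mul_self L
  have hn : Module.finrank ℂ (EuclideanSpace ℂ (Fin d)) = d := by simp
  let e := hT.eigenvectorBasis hn
  let lam := hT.eigenvalues hn
  have hin : ∀ i j, inner ℂ (L (e i)) (L (e j)) = if i = j then (lam j : ℂ) else 0 := by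
    intro i j
    rw [← LinearMap.adjoint_inner_right]
    have : LinearMap.adjoint L (L (e j)) = (lam j : ℂ) • e j :=
      hT.apply_eigenvectorBasis hn j
    rw [this, inner_smul_right, orthonormal_iff_ite.mp e.orthonormal]
    simp
  have hnn : ∀ i, 0 ≤ lam i := by
    intro i
    have h := hin i i
    rw [if_pos rfl, inner_self_eq_norm_sq_to_K] at h
    have h2 : ‖L (e i)‖ ^ 2 = lam i := by
      have h3 : ((‖L (e i)‖ ^ 2 : ℝ) : ℂ) = (lam i : ℂ) := by simpa using h
      exact Complex.ofReal_injective h3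
    rw [← h2]; positivity
  let v : Fin d → EuclideanSpace ℂ (Fin d) :=
    fun i => WithLp.toLp 2 fun k => ((Real.sqrt (lam i))⁻¹ : ℂ) * star (L (e i) k)
  have hv : Orthonormal ℂ ({i | lam i ≠ 0}.domRestrict v) := by
    rw [orthonormal_iff_ite]
    rintro ⟨i, hi⟩ ⟨j, hj⟩
    have h := hin j i
    have hs : (Real.sqrt (lam i) : ℂ) * Real.sqrt (lam i) = lam i := by
      rw [← Complex.ofReal_mul, Real.mul_self_sqrt (hnn i)]
    have hs0 : (Real.sqrt (lam i) : ℂ) ≠ 0 := by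
      intro h0; rw [h0, zero_mul] at hs; exact hi (Complex.ofReal_injective hs.symm)
    have : inner ℂ (v i) (v j) = ((Real.sqrt (lam i))⁻¹ : ℂ) * ((Real.sqrt (lam j))⁻¹ : ℂ) *
        inner ℂ (L (e j)) (L (e i)) := by
      simp only [PiLp.inner_apply, v, RCLike.inner_apply, Finset.mul_sum]
      refine Finset.sum_congr rfl fun k _ => ?_
      simp
      ring
    change inner ℂ (v i) (v j) = _
    rw [this, h]
    by_cases hij : i = j
    · subst hij
      simp only [if_true]
      rw [← hs]; field_simp
    · rw [if_neg (fun h => hij h.symm), if_neg (by simpa using hij)]; simp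
  obtain ⟨f, hf⟩ := hv.exists_orthonormalBasis_extension_of_card_eq (by simp)
  refine ⟨lam, e, f, hT.eigenvalues_antitone hn, hnn, ?_⟩
  rintro ⟨a, b⟩
  have key : ∀ i, (Real.sqrt (lam i) : ℂ) * f i b = star (L (e i) b) := by
    intro i
    by_cases hi : lam i = 0
    · have h := hin i i
      rw [if_pos rfl, hi, Complex.ofReal_zero, inner_self_eq_zero] at h
      simp [hi, h]
    · rw [hf i hi]
      have hs0 : (Real.sqrt (lam i) : ℂ) ≠ 0 := by
        simpa [Real.sqrt_eq_zero (hnn i)] using hi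
      simp only [v]
      field_simp
  have h1 : ∀ k, ∑ i, e i a * star (e i k) = if a = k then 1 else 0 := by
    intro k
    have h := congrArg (fun x : EuclideanSpace ℂ (Fin d) => x a)
      (e.sum_repr' (EuclideanSpace.single k 1 : EuclideanSpace ℂ (Fin d)))
    simpa [EuclideanSpace.inner_single_right, mul_comm, Pi.single_apply] using h
  have h2 : ∀ i, star (L (e i) b) = ∑ k, M k b * star (e i k) := by
    intro i
    simp [L, Matrix.toLpLin_apply, Matrix.mulVec, dotProduct]
  have h3 : ψ (a, b) = ∑ i, e i a * star (L (e i) b) := by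
    simp only [h2, Finset.mul_sum]
    rw [Finset.sum_comm]
    have : ∀ k, ∑ i, e i a * (M k b * star (e i k)) = M k b * if a = k then 1 else 0 := by
      intro k
      rw [← h1 k, Finset.mul_sum]
      exact Finset.sum_congr rfl fun i _ => by ring
    rw [Finset.sum_congr rfl fun k _ => this k]
    simp [M]
  rw [h3]
  refine Finset.sum_congr rfl fun i _ => ?_
  rw [← key i]
  ring

/-- Partial transpose on the second factor. -/
def partialTranspose {α β : Type} (T : Matrix (α × β) (α × β) ℂ) :
    Matrix (α × β) (α × β) ℂ :=
  Matrix.of fun p q => T (p.1, q.2) (q.1, p.2)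

/-- A separable positive operator: a finite sum of products of positive operators. -/
def IsSeparable {α β : Type} (T : Matrix (α × β) (α × β) ℂ) : Prop :=
  ∃ (m : ℕ) (P : Fin m → Matrix α α ℂ) (Q : Fin m → Matrix β β ℂ),
    (∀ i, (P i).PosSemidef) ∧ (∀ i, (Q i).PosSemidef) ∧ T = ∑ i, P i ⊗ₖ Q i

/-- `{T, 1 - T}` is a two-outcome measurement (POVM). -/
def IsEffect {γ : Type} [DecidableEq γ] (T : Matrix γ γ ℂ) : Prop :=
  T.PosSemidef ∧ (1 - T).PosSemidef

/-- `{T, 1 - T}` can be implemented by one-way LOCC: Alice performs a measurement `A`, sends the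
result `i` to Bob, who then performs the two-outcome measurement `{B i, 1 - B i}`. -/
def IsLOCC1 {α β : Type} [DecidableEq α] [DecidableEq β]
    (T : Matrix (α × β) (α × β) ℂ) : Prop :=
  ∃ (m : ℕ) (A : Fin m → Matrix α α ℂ) (B : Fin m → Matrix β β ℂ),
    (∀ i, (A i).PosSemidef) ∧ ∑ i, A i = 1 ∧ (∀ i, IsEffect (B i)) ∧ T = ∑ i, A i ⊗ₖ B i

/-- `IsLOCC T`: some LOCC protocol with finitely many rounds implements `{T, 1 - T}`, where `T` is
the operator of the outcome "accept". A protocol is a finite tree. At a leaf the parties accept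
(`T = 1`) or reject (`T = 0`). At an inner node one party applies a quantum instrument with Kraus
operators `K i` to its own system (whose dimension may change, so ancillas are allowed) and
announces the outcome `i`; they go on with a protocol depending on `i`, whose accepting operator
is `T i`. -/
inductive IsLOCC : ∀ {α β : Type} [Fintype α] [DecidableEq α] [Fintype β] [DecidableEq β],
    Matrix (α × β) (α × β) ℂ → Prop
  | accept {α β : Type} [Fintype α] [DecidableEq α] [Fintype β] [DecidableEq β] :
      IsLOCC (1 : Matrix (α × β) (α × β) ℂ)
  | reject {α β : Type} [Fintype α] [DecidableEq α] [Fintype β] [DecidableEq β] :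
      IsLOCC (0 : Matrix (α × β) (α × β) ℂ)
  | alice {α α' β : Type} [Fintype α] [DecidableEq α] [Fintype α'] [DecidableEq α']
      [Fintype β] [DecidableEq β] {m : ℕ} (K : Fin m → Matrix α' α ℂ)
      (T : Fin m → Matrix (α' × β) (α' × β) ℂ) (hK : ∑ i, (K i)ᴴ * K i = 1)
      (hT : ∀ i, IsLOCC (T i)) :
      IsLOCC (∑ i, (K i ⊗ₖ (1 : Matrix β β ℂ))ᴴ * T i * (K i ⊗ₖ (1 : Matrix β β ℂ)))
  | bob {α β β' : Type} [Fintype α] [DecidableEq α] [Fintype β] [DecidableEq β]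
      [Fintype β'] [DecidableEq β'] {m : ℕ} (K : Fin m → Matrix β' β ℂ)
      (T : Fin m → Matrix (α × β') (α × β') ℂ) (hK : ∑ i, (K i)ᴴ * K i = 1)
      (hT : ∀ i, IsLOCC (T i)) :
      IsLOCC (∑ i, ((1 : Matrix α α ℂ) ⊗ₖ K i)ᴴ * T i * ((1 : Matrix α α ℂ) ⊗ₖ K i))

/-- The classes of measurements under consideration. -/
inductive MeasClass
  | LOCC1
  | LOCC
  | SEP
  | PPT
  | ALL

/-- `X.Mem T`: the two-outcome measurement `{T, 1 - T}` belongs to the class `X`. -/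
def MeasClass.Mem {α β : Type} [Fintype α] [DecidableEq α] [Fintype β] [DecidableEq β]
    (X : MeasClass) (T : Matrix (α × β) (α × β) ℂ) : Prop :=
  match X with
  | .LOCC1 => IsLOCC1 T
  | .LOCC => IsLOCC T
  | .SEP => IsSeparable T ∧ IsSeparable (1 - T)
  | .PPT => IsEffect T ∧ (partialTranspose T).PosSemidef ∧ (partialTranspose (1 - T)).PosSemidef
  | .ALL => IsEffect T

/-- The minimax error probability: the infimum over the measurements `{T, 1 - T}` in `X` of the
supremum over all states `σ` with `Tr ρσ ≤ θ` of `½ Tr ((1 - T)ρ + Tσ)`. -/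
noncomputable def minimaxError {α β : Type} [Fintype α] [DecidableEq α] [Fintype β]
    [DecidableEq β] (X : MeasClass) (ρ : Matrix (α × β) (α × β) ℂ) (θ : ℝ) : ℝ≥0∞ :=
  ⨅ (T : Matrix (α × β) (α × β) ℂ) (_ : X.Mem T),
    ⨆ (σ : Matrix (α × β) (α × β) ℂ) (_ : IsState σ ∧ (ρ * σ).trace.re ≤ θ),
      ENNReal.ofReal (1 / 2 * ((1 - T) * ρ + T * σ).trace.re)

/-- `ρ^{⊗ n}`, as an operator shared by Alice (who holds the first factor of every copy) and Bob
(who holds the second factor of every copy). -/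
def tensorPower {α β : Type} (ρ : Matrix (α × β) (α × β) ℂ) (n : ℕ) :
    Matrix ((Fin n → α) × (Fin n → β)) ((Fin n → α) × (Fin n → β)) ℂ :=
  Matrix.of fun p q => ∏ k, ρ (p.1 k, p.2 k) (q.1 k, q.2 k)

/-- `-(1/n) log P_err^X(ρ^{⊗ n}; θ^n)`, in the extended reals. -/
noncomputable def errorExponent {α β : Type} [Fintype α] [DecidableEq α] [Fintype β]
    [DecidableEq β] (X : MeasClass) (ρ : Matrix (α × β) (α × β) ℂ) (θ : ℝ) (n : ℕ) : EReal :=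
  -(ENNReal.log (minimaxError X (tensorPower ρ n) (θ ^ n)) / (n : EReal))

/-- The asymptotic rate `ξ^X(ρ; θ)`, the limit of the error exponents. -/
noncomputable def rate {α β : Type} [Fintype α] [DecidableEq α] [Fintype β]
    [DecidableEq β] (X : MeasClass) (ρ : Matrix (α × β) (α × β) ℂ) (θ : ℝ) : EReal :=
  limUnder atTop (errorExponent X ρ θ)

end PureStateTest

/-! The classes are nested, `LOCC1` ⊂ `LOCC` ⊂ `SEP` ⊂ `PPT` ⊂ `ALL`, so the minimax error decreases
along the chain. It therefore suffices to bound the `LOCC1` error from above, bound the `PPT` error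
from below and compute the `ALL` error. Local unitaries leave these three classes invariant and
bring `ρ^{⊗n}` to the standard form `φ = ∑ √λ_I |I⟩⊗|I⟩`, where `λ_I` is a product of `n` Schmidt
coefficients.

For `ALL`, the test `T = |φ⟩⟨φ|` has error at most `θ/2`, and mixing `φ` with a vector orthogonal to
it shows that this is optimal (`minimaxError_ALL_le`, `le_minimaxError_ALL`).

For `LOCC1`, Alice measures with random sign vectors and Bob projects onto the conditional state of
`φ`. Fourth moments of signs show that this test is `|φ⟩⟨φ|` plus an operator of norm at most twice
the largest Schmidt coefficient, so the error is at most `(θ^n + 2λ^n)/2` (`minimaxError_LOCC1_le`).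

For `PPT`, two distinct indices with equal Schmidt coefficient `μ` yield a state orthogonal to `φ`
which every `PPT` test confuses with `φ`, with error at least `μ/8` (`le_minimaxError_PPT`).
Entanglement gives a second positive coefficient `λ_i`; placing it in the first or in the second
copy gives two such indices, with `μ = λ_i λ^(n-1)`. Together with the `ALL` bound `θ^n/2`, all
local errors are of order `max(θ, λ)^n`. -/

namespace PureStateTest

/-! ### Inclusions between the measurement classes. -/

section Classes

/-- Square root of a positive semidefinite matrix, as a Kraus operator. -/
theorem exists_conjTranspose_mul_self_eq {γ : Type} [Fintype γ] {A : Matrix γ γ ℂ}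
    (hA : A.PosSemidef) : ∃ K : Matrix γ γ ℂ, Kᴴ * K = A := by
  classical
  open scoped MatrixOrder in
  obtain ⟨K, hK⟩ := CStarAlgebra.nonneg_iff_eq_star_mul_self.mp hA.nonneg
  exact ⟨K, hK.symm⟩

variable {α β α' β' : Type}

theorem isSeparable_of_fintype {κ : Type} [Fintype κ] (P : κ → Matrix α α ℂ)
    (Q : κ → Matrix β β ℂ) (hP : ∀ i, (P i).PosSemidef) (hQ : ∀ i, (Q i).PosSemidef) :
    IsSeparable (∑ i, P i ⊗ₖ Q i) := by
  refine ⟨Fintype.card κ, fun i => P ((Fintype.equivFin κ).symm i),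
    fun i => Q ((Fintype.equivFin κ).symm i), fun i => hP _, fun i => hQ _, ?_⟩
  exact ((Fintype.equivFin κ).symm.sum_comp fun i => P i ⊗ₖ Q i).symm

theorem IsSeparable.kronecker {P : Matrix α α ℂ} {Q : Matrix β β ℂ} (hP : P.PosSemidef)
    (hQ : Q.PosSemidef) : IsSeparable (P ⊗ₖ Q) := by
  simpa using isSeparable_of_fintype (κ := Unit) (fun _ => P) (fun _ => Q) (fun _ => hP)
    (fun _ => hQ)

theorem IsSeparable.sum {κ : Type} [Fintype κ] {T : κ → Matrix (α × β) (α × β) ℂ}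
    (hT : ∀ i, IsSeparable (T i)) : IsSeparable (∑ i, T i) := by
  choose m P Q hP hQ h using hT
  have := isSeparable_of_fintype (κ := Σ i, Fin (m i)) (fun x => P x.1 x.2) (fun x => Q x.1 x.2)
    (fun x => hP _ _) (fun x => hQ _ _)
  rw [Fintype.sum_sigma] at this
  simpa only [← h] using this

theorem IsSeparable.zero : IsSeparable (0 : Matrix (α × β) (α × β) ℂ) :=
  ⟨0, fun _ => 0, fun _ => 0, fun i => i.elim0, fun i => i.elim0, by simp⟩

theorem IsSeparable.one [DecidableEq α] [DecidableEq β] :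
    IsSeparable (1 : Matrix (α × β) (α × β) ℂ) := by
  rw [← one_kronecker_one]
  exact .kronecker .one .one

theorem IsSeparable.conj [Fintype α] [Fintype β] [Finite α'] [Finite β']
    {T : Matrix (α × β) (α × β) ℂ} (hT : IsSeparable T)
    (K : Matrix α α' ℂ) (L : Matrix β β' ℂ) : IsSeparable ((K ⊗ₖ L)ᴴ * T * (K ⊗ₖ L)) := by
  obtain ⟨m, P, Q, hP, hQ, rfl⟩ := hT
  rw [Matrix.mul_sum, Matrix.sum_mul]
  refine .sum fun i => ?_
  rw [conjTranspose_kronecker, ← mul_kronecker_mul, ← mul_kronecker_mul]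
  exact .kronecker ((hP i).conjTranspose_mul_mul_same K) ((hQ i).conjTranspose_mul_mul_same L)

theorem one_sub_sum_conj {γ γ' : Type} [Fintype γ] [DecidableEq γ] [Fintype γ'] [DecidableEq γ']
    {m : ℕ} (K : Fin m → Matrix γ' γ ℂ) (T : Fin m → Matrix γ' γ' ℂ)
    (hK : ∑ i, (K i)ᴴ * K i = 1) :
    1 - ∑ i, (K i)ᴴ * T i * K i = ∑ i, (K i)ᴴ * (1 - T i) * K i := by
  simp only [Matrix.mul_sub, Matrix.sub_mul, Finset.sum_sub_distrib, Matrix.mul_one, hK]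

theorem sum_kronecker_one {m : ℕ} (A : Fin m → Matrix α α ℂ) (B : Matrix β β ℂ) :
    ∑ i, A i ⊗ₖ B = (∑ i, A i) ⊗ₖ B := by
  ext p q; simp [Matrix.sum_apply, kroneckerMap_apply, Finset.sum_mul]

theorem sum_one_kronecker {m : ℕ} (A : Matrix α α ℂ) (B : Fin m → Matrix β β ℂ) :
    ∑ i, A ⊗ₖ B i = A ⊗ₖ (∑ i, B i) := by
  ext p q; simp [Matrix.sum_apply, kroneckerMap_apply, Finset.mul_sum]

/-- Induction on the protocol tree. Completeness of the Kraus operators turns the rejecting operator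
into the same conjugated sum over the rejecting operators of the subtrees, so both outcomes are
carried along together. -/
theorem IsLOCC.isSeparable [Fintype α] [DecidableEq α] [Fintype β] [DecidableEq β]
    {T : Matrix (α × β) (α × β) ℂ} (hT : IsLOCC T) :
    IsSeparable T ∧ IsSeparable (1 - T) := by
  induction hT with
  | accept => exact ⟨.one, by simpa using .zero⟩
  | reject => exact ⟨.zero, by simpa using .one⟩
  | alice K T hK hT ih =>
    rw [one_sub_sum_conj]
    · exact ⟨.sum fun i => (ih i).1.conj _ _, .sum fun i => (ih i).2.conj _ _⟩
    · simp only [conjTranspose_kronecker, ← mul_kronecker_mul, conjTranspose_one, mul_one,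
        sum_kronecker_one, hK, one_kronecker_one]
  | bob K T hK hT ih =>
    rw [one_sub_sum_conj]
    · exact ⟨.sum fun i => (ih i).1.conj _ _, .sum fun i => (ih i).2.conj _ _⟩
    · simp only [conjTranspose_kronecker, ← mul_kronecker_mul, conjTranspose_one, mul_one,
        sum_one_kronecker, hK, one_kronecker_one]

theorem isLOCC_one_kronecker [Fintype α] [DecidableEq α] [Fintype β] [DecidableEq β]
    {B : Matrix β β ℂ} (hB : IsEffect B) : IsLOCC ((1 : Matrix α α ℂ) ⊗ₖ B) := by
  obtain ⟨K, hK⟩ := exists_conjTranspose_mul_self_eq hB.1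
  obtain ⟨L, hL⟩ := exists_conjTranspose_mul_self_eq hB.2
  -- Bob's instrument consists of roots of `B` and `1 - B`; the first outcome accepts and the second
  -- rejects.
  have := IsLOCC.bob (α := α) ![K, L] ![1, 0] (by simp [Fin.sum_univ_two, hK, hL])
    (by intro i; fin_cases i; exacts [.accept, .reject])
  simpa [Fin.sum_univ_two, conjTranspose_kronecker, ← mul_kronecker_mul, hK] using this

theorem IsLOCC1.isLOCC [Fintype α] [DecidableEq α] [Fintype β] [DecidableEq β]
    {T : Matrix (α × β) (α × β) ℂ} (hT : IsLOCC1 T) : IsLOCC T := by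
  obtain ⟨m, A, B, hA, hA1, hB, rfl⟩ := hT
  choose K hK using fun i => exists_conjTranspose_mul_self_eq (hA i)
  have := IsLOCC.alice (β := β) K (fun i => 1 ⊗ₖ B i) (by simp only [hK, hA1])
    (fun i => isLOCC_one_kronecker (hB i))
  simpa [conjTranspose_kronecker, ← mul_kronecker_mul, hK] using this

theorem partialTranspose_sum {κ : Type} [Fintype κ] (T : κ → Matrix (α × β) (α × β) ℂ) :
    partialTranspose (∑ i, T i) = ∑ i, partialTranspose (T i) := by
  ext p q; simp [partialTranspose, Matrix.sum_apply]

theorem partialTranspose_kronecker (P : Matrix α α ℂ) (Q : Matrix β β ℂ) :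
    partialTranspose (P ⊗ₖ Q) = P ⊗ₖ Qᵀ := by
  ext p q; simp [partialTranspose, kroneckerMap_apply]

theorem IsSeparable.posSemidef [Fintype α] [Fintype β] {T : Matrix (α × β) (α × β) ℂ}
    (hT : IsSeparable T) : T.PosSemidef := by
  obtain ⟨m, P, Q, hP, hQ, rfl⟩ := hT
  exact posSemidef_sum _ fun i _ => (hP i).kronecker (hQ i)

theorem IsSeparable.posSemidef_partialTranspose [Fintype α] [Fintype β]
    {T : Matrix (α × β) (α × β) ℂ} (hT : IsSeparable T) : (partialTranspose T).PosSemidef := by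
  obtain ⟨m, P, Q, hP, hQ, rfl⟩ := hT
  rw [partialTranspose_sum]
  simp only [partialTranspose_kronecker]
  exact posSemidef_sum _ fun i _ => (hP i).kronecker (hQ i).transpose

variable [Fintype α] [DecidableEq α] [Fintype β] [DecidableEq β]
  {T : Matrix (α × β) (α × β) ℂ}

theorem mem_LOCC_of_LOCC1 (h : MeasClass.LOCC1.Mem T) : MeasClass.LOCC.Mem T :=
  IsLOCC1.isLOCC h

theorem mem_SEP_of_LOCC (h : MeasClass.LOCC.Mem T) : MeasClass.SEP.Mem T :=
  IsLOCC.isSeparable h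

theorem mem_PPT_of_SEP (h : MeasClass.SEP.Mem T) : MeasClass.PPT.Mem T :=
  ⟨⟨h.1.posSemidef, h.2.posSemidef⟩, h.1.posSemidef_partialTranspose,
    h.2.posSemidef_partialTranspose⟩

theorem mem_ALL_of_PPT (h : MeasClass.PPT.Mem T) : MeasClass.ALL.Mem T := h.1

theorem minimaxError_anti {X Y : MeasClass}
    (h : ∀ T : Matrix (α × β) (α × β) ℂ, X.Mem T → Y.Mem T)
    (ρ : Matrix (α × β) (α × β) ℂ) (θ : ℝ) : minimaxError Y ρ θ ≤ minimaxError X ρ θ :=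
  iInf_mono fun T => iInf_mono' fun hT => ⟨h T hT, le_rfl⟩

end Classes

/-! ### Invariance under local unitaries. -/

section LocalUnitary

variable {α β : Type} [Fintype α] [DecidableEq α] [Fintype β] [DecidableEq β]

/-- Conjugation by `W` carries tests for `ρ` to tests for the rotated state, and conjugating back
matches the admissible `σ`. The reverse inequality comes from using `Wᴴ` in place of `W`. -/
theorem minimaxError_conj_le {X : MeasClass} {W : Matrix (α × β) (α × β) ℂ} (hW : Wᴴ * W = 1)
    (hX : ∀ T, X.Mem T → X.Mem (W * T * Wᴴ)) (ρ : Matrix (α × β) (α × β) ℂ) (θ : ℝ) :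
    minimaxError X (W * ρ * Wᴴ) θ ≤ minimaxError X ρ θ := by
  have hW' : W * Wᴴ = 1 := mul_eq_one_comm.mp hW
  have cyc : ∀ M N : Matrix (α × β) (α × β) ℂ,
      ((W * M * Wᴴ) * N).trace = (M * (Wᴴ * N * W)).trace := fun M N => by
    rw [mul_assoc W, mul_assoc W, trace_mul_comm W]; simp only [mul_assoc]
  refine le_iInf fun T => le_iInf fun hT => ?_
  refine iInf_le_of_le (W * T * Wᴴ) (iInf_le_of_le (hX T hT) ?_)
  refine iSup_le fun σ => iSup_le fun hσ => ?_
  refine le_iSup_of_le (Wᴴ * σ * W) (le_iSup_of_le ⟨⟨hσ.1.1.conjTranspose_mul_mul_same W, ?_⟩, ?_⟩ ?_)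
  · rw [trace_mul_comm, ← mul_assoc, hW', one_mul, hσ.1.2]
  · rw [← cyc]; exact hσ.2
  · apply le_of_eq
    congr 3
    have h1 : (1 - W * T * Wᴴ) = W * (1 - T) * Wᴴ := by
      rw [mul_sub, sub_mul, mul_one, hW']
    rw [trace_add, trace_add, h1, cyc, cyc T σ]
    congr 2
    simp only [mul_assoc, hW, mul_one]
    rw [← mul_assoc Wᴴ, hW, one_mul]

theorem one_sub_conj {γ : Type} [Fintype γ] [DecidableEq γ] {W : Matrix γ γ ℂ}
    (hW : Wᴴ * W = 1) (T : Matrix γ γ ℂ) : 1 - W * T * Wᴴ = W * (1 - T) * Wᴴ := by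
  rw [mul_sub, sub_mul, mul_one, mul_eq_one_comm.mp hW]

theorem isEffect_conj {γ : Type} [Fintype γ] [DecidableEq γ] {W T : Matrix γ γ ℂ}
    (hW : Wᴴ * W = 1) (hT : IsEffect T) : IsEffect (W * T * Wᴴ) := by
  refine ⟨hT.1.mul_mul_conjTranspose_same W, ?_⟩
  rw [one_sub_conj hW]
  exact hT.2.mul_mul_conjTranspose_same W

theorem kronecker_conjTranspose_mul_self {U : Matrix α α ℂ} {V : Matrix β β ℂ}
    (hU : Uᴴ * U = 1) (hV : Vᴴ * V = 1) : (U ⊗ₖ V)ᴴ * (U ⊗ₖ V) = 1 := by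
  rw [conjTranspose_kronecker, ← mul_kronecker_mul, hU, hV, one_kronecker_one]

theorem mem_LOCC1_conj {U : Matrix α α ℂ} {V : Matrix β β ℂ} (hU : Uᴴ * U = 1)
    (hV : Vᴴ * V = 1) {T : Matrix (α × β) (α × β) ℂ} (hT : MeasClass.LOCC1.Mem T) :
    MeasClass.LOCC1.Mem ((U ⊗ₖ V) * T * (U ⊗ₖ V)ᴴ) := by
  obtain ⟨m, A, B, hA, hA1, hB, rfl⟩ := hT
  refine ⟨m, fun i => U * A i * Uᴴ, fun i => V * B i * Vᴴ,
    fun i => (hA i).mul_mul_conjTranspose_same U, ?_, fun i => isEffect_conj hV (hB i), ?_⟩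
  · rw [← Finset.sum_mul, ← Finset.mul_sum, hA1, mul_one, mul_eq_one_comm.mp hU]
  · simp only [conjTranspose_kronecker, Finset.mul_sum, Finset.sum_mul, mul_kronecker_mul]

/-- By linearity it is enough to treat products of matrix units, where transposing `V Q Vᴴ` replaces
`V` by its entrywise conjugate `Vᴴᵀ`. -/
theorem partialTranspose_conj (U : Matrix α α ℂ) (V : Matrix β β ℂ)
    (T : Matrix (α × β) (α × β) ℂ) :
    partialTranspose ((U ⊗ₖ V) * T * (U ⊗ₖ V)ᴴ) =
      (U ⊗ₖ Vᴴᵀ) * partialTranspose T * (U ⊗ₖ Vᴴᵀ)ᴴ := by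
  have hT : T = ∑ p, ∑ q, T p q • (single p.1 q.1 (1 : ℂ) ⊗ₖ single p.2 q.2 (1 : ℂ)) := by
    ext ⟨r₁, r₂⟩ ⟨s₁, s₂⟩
    simp [Matrix.sum_apply, kroneckerMap_apply, single_apply, Fintype.sum_prod_type, ite_and]
  have hsmul : ∀ (c : ℂ) (M : Matrix (α × β) (α × β) ℂ),
      partialTranspose (c • M) = c • partialTranspose M := fun c M => by
    ext p q; simp [partialTranspose]
  rw [hT]
  simp only [Finset.mul_sum, Finset.sum_mul, partialTranspose_sum, mul_smul_comm, smul_mul_assoc,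
    hsmul, partialTranspose_kronecker, conjTranspose_kronecker, ← mul_kronecker_mul,
    transpose_mul]
  have hV : Vᴴᵀᴴ = Vᵀ := by ext; simp
  simp [mul_assoc, hV]

theorem mem_PPT_conj {U : Matrix α α ℂ} {V : Matrix β β ℂ} (hU : Uᴴ * U = 1)
    (hV : Vᴴ * V = 1) {T : Matrix (α × β) (α × β) ℂ} (hT : MeasClass.PPT.Mem T) :
    MeasClass.PPT.Mem ((U ⊗ₖ V) * T * (U ⊗ₖ V)ᴴ) := by
  have hW := kronecker_conjTranspose_mul_self hU hV
  refine ⟨isEffect_conj hW hT.1, ?_, ?_⟩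
  · rw [partialTranspose_conj]
    exact hT.2.1.mul_mul_conjTranspose_same _
  · rw [one_sub_conj hW, partialTranspose_conj]
    exact hT.2.2.mul_mul_conjTranspose_same _

end LocalUnitary

/-! ### Quadratic forms of positive operators and effects. -/

section QuadraticForm

variable {γ : Type} [Fintype γ]

theorem trace_mul_pureState (M : Matrix γ γ ℂ) (v : γ → ℂ) :
    (M * pureState v).trace = star v ⬝ᵥ M *ᵥ v := by
  rw [pureState, mul_vecMulVec, trace_vecMulVec, dotProduct_comm]

theorem pureState_posSemidef (v : γ → ℂ) : (pureState v).PosSemidef :=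
  posSemidef_vecMulVec_self_star v

theorem trace_pureState (v : γ → ℂ) : (pureState v).trace = star v ⬝ᵥ v := by
  rw [pureState, trace_vecMulVec, dotProduct_comm]

theorem dotProduct_pureState_mulVec (u v w : γ → ℂ) :
    star u ⬝ᵥ pureState v *ᵥ w = (star u ⬝ᵥ v) * (star v ⬝ᵥ w) := by
  rw [pureState, vecMulVec_mulVec, dotProduct_smul]
  simp

theorem pureState_mulVec (W : Matrix γ γ ℂ) (v : γ → ℂ) :
    pureState (W *ᵥ v) = W * pureState v * Wᴴ := by
  rw [pureState, pureState, mul_vecMulVec, vecMulVec_mul, star_mulVec]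

theorem isEffect_pureState [DecidableEq γ] {v : γ → ℂ} (hv : star v ⬝ᵥ v = 1) :
    IsEffect (pureState v) := by
  refine ⟨pureState_posSemidef v, ?_⟩
  have hP : pureState v * pureState v = pureState v := by
    rw [pureState, vecMulVec_mul_vecMulVec, hv, one_smul]
  have hH : (pureState v)ᴴ = pureState v := (pureState_posSemidef v).isHermitian
  have h : 1 - pureState v = (1 - pureState v)ᴴ * (1 - pureState v) := by
    rw [conjTranspose_sub, conjTranspose_one, hH]
    simp [mul_sub, sub_mul, hP]
  rw [h]
  exact posSemidef_conjTranspose_mul_self _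

theorem IsHermitian.re_quadraticForm_add {M : Matrix γ γ ℂ} (hM : M.IsHermitian) (u v : γ → ℂ)
    (a b : ℝ) :
    (star ((a : ℂ) • u + (b : ℂ) • v) ⬝ᵥ M *ᵥ ((a : ℂ) • u + (b : ℂ) • v)).re =
      a ^ 2 * (star u ⬝ᵥ M *ᵥ u).re + b ^ 2 * (star v ⬝ᵥ M *ᵥ v).re +
        2 * a * b * (star u ⬝ᵥ M *ᵥ v).re := by
  have h : (star v ⬝ᵥ M *ᵥ u).re = (star u ⬝ᵥ M *ᵥ v).re := by
    have : star (star u ⬝ᵥ M *ᵥ v) = star v ⬝ᵥ M *ᵥ u := by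
      rw [star_dotProduct, star_mulVec, star_star, hM.eq, ← dotProduct_mulVec]
    rw [← this]; simp
  simp only [star_add, star_smul, mulVec_add, mulVec_smul, add_dotProduct, dotProduct_add,
    smul_dotProduct, dotProduct_smul, smul_eq_mul, Complex.add_re, RCLike.star_def,
    Complex.conj_ofReal, Complex.re_ofReal_mul, h]
  ring

theorem star_single_dotProduct_mulVec_single [DecidableEq γ] (M : Matrix γ γ ℂ) (p q : γ) :
    star (Pi.single p (1 : ℂ)) ⬝ᵥ M *ᵥ Pi.single q 1 = M p q := by
  rw [← Pi.single_star]; simp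

theorem PosSemidef.re_quadraticForm_nonneg {M : Matrix γ γ ℂ} (hM : M.PosSemidef) (u : γ → ℂ) :
    0 ≤ (star u ⬝ᵥ M *ᵥ u).re := by
  simpa using (RCLike.nonneg_iff.mp (hM.dotProduct_mulVec_nonneg u)).1

theorem PosSemidef.two_mul_re_entry_le [DecidableEq γ] {M : Matrix γ γ ℂ} (hM : M.PosSemidef)
    (p q : γ) : 2 * (M p q).re ≤ (M p p).re + (M q q).re := by
  have h := PosSemidef.re_quadraticForm_nonneg hM
    (((1 : ℝ) : ℂ) • Pi.single p 1 + ((-1 : ℝ) : ℂ) • Pi.single q 1)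
  rw [IsHermitian.re_quadraticForm_add hM.isHermitian] at h
  simp only [star_single_dotProduct_mulVec_single] at h
  linarith

theorem IsEffect.re_quadraticForm_le_one [DecidableEq γ] {T : Matrix γ γ ℂ} (hT : IsEffect T)
    {u : γ → ℂ} (hu : star u ⬝ᵥ u = 1) : (star u ⬝ᵥ T *ᵥ u).re ≤ 1 := by
  have h := PosSemidef.re_quadraticForm_nonneg hT.2 u
  rw [sub_mulVec, one_mulVec, dotProduct_sub, hu] at h
  simpa using h

end QuadraticForm

/-! ### Error bounds for a vector in Schmidt form: `ALL`, and `PPT` from below. -/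

section SchmidtVector

variable {ι : Type} [Fintype ι] [DecidableEq ι]

/-- The vector `∑ i, √(lam i) • |i⟩ ⊗ |i⟩`. -/
noncomputable def schmidtVector (lam : ι → ℝ) : ι × ι → ℂ :=
  fun p => if p.1 = p.2 then (Real.sqrt (lam p.1) : ℂ) else 0

theorem star_schmidtVector {ι : Type} [DecidableEq ι] {lam : ι → ℝ} :
    star (schmidtVector lam) = schmidtVector lam := by
  ext p; simp only [schmidtVector, Pi.star_apply]; split_ifs <;> simp

variable {lam : ι → ℝ}

theorem sqrt_mul_sqrt_complex {x : ℝ} (hx : 0 ≤ x) :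
    (Real.sqrt x : ℂ) * (Real.sqrt x : ℂ) = x := by
  rw [← Complex.ofReal_mul, Real.mul_self_sqrt hx]

theorem schmidtVector_dotProduct_self (h0 : ∀ i, 0 ≤ lam i) (h1 : ∑ i, lam i = 1) :
    star (schmidtVector lam) ⬝ᵥ schmidtVector lam = 1 := by
  rw [star_schmidtVector]
  simp [schmidtVector, dotProduct, Fintype.sum_prod_type, sqrt_mul_sqrt_complex, h0]
  exact_mod_cast h1

theorem le_minimaxError {X : MeasClass} {ρ : Matrix (ι × ι) (ι × ι) ℂ} {θ x : ℝ}
    (h : ∀ T, X.Mem T → ∃ σ, (IsState σ ∧ (ρ * σ).trace.re ≤ θ) ∧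
      x ≤ 1 / 2 * ((1 - T) * ρ + T * σ).trace.re) : ENNReal.ofReal x ≤ minimaxError X ρ θ := by
  refine le_iInf fun T => le_iInf fun hT => ?_
  obtain ⟨σ, hσ, hx⟩ := h T hT
  exact le_iSup_of_le σ (le_iSup_of_le hσ (ENNReal.ofReal_le_ofReal hx))

theorem minimaxError_le {X : MeasClass} {ρ T : Matrix (ι × ι) (ι × ι) ℂ} {θ x : ℝ}
    (hT : X.Mem T) (h : ∀ σ, IsState σ → (ρ * σ).trace.re ≤ θ →
      1 / 2 * ((1 - T) * ρ + T * σ).trace.re ≤ x) : minimaxError X ρ θ ≤ ENNReal.ofReal x :=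
  iInf_le_of_le T <| iInf_le_of_le hT <| iSup_le fun σ => iSup_le fun hσ =>
    ENNReal.ofReal_le_ofReal (h σ hσ.1 hσ.2)

theorem minimaxError_ALL_le (h0 : ∀ i, 0 ≤ lam i) (h1 : ∑ i, lam i = 1) (θ : ℝ) :
    minimaxError .ALL (pureState (schmidtVector lam)) θ ≤ ENNReal.ofReal (θ / 2) := by
  have hn := schmidtVector_dotProduct_self h0 h1
  refine minimaxError_le (T := pureState (schmidtVector lam)) (isEffect_pureState hn)
    fun σ _ hσ => ?_
  rw [trace_add, trace_mul_pureState, sub_mulVec, one_mulVec, dotProduct_sub,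
    dotProduct_pureState_mulVec, hn]
  simp only [mul_one, sub_self, zero_add]
  linarith

/-- The adversary plays `θ φ + (1 - θ)|ij⟩`, as a mixture of states, with `|ij⟩` orthogonal to `φ`.
If `T` accepts `φ` with probability `a`, twice the error is at least `1 - a + θ a ≥ θ`. -/
theorem le_minimaxError_ALL (h0 : ∀ i, 0 ≤ lam i) (h1 : ∑ i, lam i = 1) {i j : ι} (hij : i ≠ j)
    {θ : ℝ} (hθ0 : 0 ≤ θ) (hθ1 : θ ≤ 1) :
    ENNReal.ofReal (θ / 2) ≤ minimaxError .ALL (pureState (schmidtVector lam)) θ := by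
  set φ := schmidtVector lam with hφ
  have hn : star φ ⬝ᵥ φ = 1 := schmidtVector_dotProduct_self h0 h1
  have hz : φ (i, j) = 0 := by simp [hφ, schmidtVector, hij]
  refine le_minimaxError fun T hT => ⟨(θ : ℂ) • pureState φ +
    ((1 - θ : ℝ) : ℂ) • pureState (Pi.single (i, j) 1), ⟨⟨?_, ?_⟩, ?_⟩, ?_⟩
  · refine .add (.smul (pureState_posSemidef _) ?_) (.smul (pureState_posSemidef _) ?_)
    · exact_mod_cast hθ0
    · exact_mod_cast sub_nonneg.mpr hθ1
  · rw [trace_add, trace_smul, trace_smul, trace_pureState, trace_pureState, hn,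
      ← Pi.single_star]
    simp
  · rw [mul_add, trace_add, mul_smul_comm, mul_smul_comm, trace_smul, trace_smul,
      trace_mul_pureState, trace_mul_pureState, dotProduct_pureState_mulVec,
      dotProduct_pureState_mulVec, hn]
    simp [hz]
  · have ha := IsEffect.re_quadraticForm_le_one hT hn
    have hb := PosSemidef.re_quadraticForm_nonneg hT.1 (Pi.single (i, j) 1)
    rw [mul_add, mul_smul_comm, mul_smul_comm, trace_add, trace_add, trace_smul, trace_smul,
      trace_mul_pureState, trace_mul_pureState, trace_mul_pureState, sub_mulVec, one_mulVec,
      dotProduct_sub, hn]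
    simp only [Complex.add_re, Complex.sub_re, Complex.one_re, smul_eq_mul, Complex.re_ofReal_mul]
    nlinarith [mul_nonneg (sub_nonneg.mpr hθ1) hb, mul_nonneg (sub_nonneg.mpr hθ1)
      (sub_nonneg.mpr ha)]

/-- An effect that almost surely accepts `schmidtVector lam` accepts `|i⟩ ⊗ |i⟩` with a
probability of order `lam i`. -/
theorem IsEffect.half_schmidt_le (h0 : ∀ i, 0 ≤ lam i) (h1 : ∑ i, lam i = 1)
    {T : Matrix (ι × ι) (ι × ι) ℂ} (hT : IsEffect T) (i : ι) :
    lam i / 2 ≤ (T (i, i) (i, i)).re +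
      (star (schmidtVector lam) ⬝ᵥ (1 - T) *ᵥ schmidtVector lam).re := by
  set φ := schmidtVector lam with hφ
  have hn : star φ ⬝ᵥ φ = 1 := schmidtVector_dotProduct_self h0 h1
  have he : star (Pi.single (i, i) (1 : ℂ)) ⬝ᵥ (Pi.single (i, i) 1 : ι × ι → ℂ) = 1 := by
    rw [← Pi.single_star]; simp
  set s := Real.sqrt (lam i) with hs
  have hss : s ^ 2 = lam i := Real.sq_sqrt (h0 i)
  have hef : star (Pi.single (i, i) (1 : ℂ)) ⬝ᵥ φ = s := by
    rw [← Pi.single_star]; simp [hφ, schmidtVector, hs]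
  -- With `s = √(lam i)` and overlap `⟨ii|φ⟩ = s`, test `T` on `2|ii⟩ - sφ` and `1 - T` on `s|ii⟩ -
  -- 2φ`. In the sum of the two inequalities the cross terms `⟨ii|T|φ⟩` cancel.
  have hA := PosSemidef.re_quadraticForm_nonneg hT.1
    (((2 : ℝ) : ℂ) • Pi.single (i, i) 1 + ((-s : ℝ) : ℂ) • φ)
  have hB := PosSemidef.re_quadraticForm_nonneg hT.2
    (((s : ℝ) : ℂ) • Pi.single (i, i) 1 + ((-2 : ℝ) : ℂ) • φ)
  rw [IsHermitian.re_quadraticForm_add hT.1.isHermitian] at hA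
  rw [IsHermitian.re_quadraticForm_add hT.2.isHermitian] at hB
  have h2 := PosSemidef.re_quadraticForm_nonneg hT.1 (Pi.single (i, i) 1)
  have h3 := PosSemidef.re_quadraticForm_nonneg hT.2 φ
  simp only [sub_mulVec, one_mulVec, dotProduct_sub, hn, he, hef,
    star_single_dotProduct_mulVec_single, Complex.sub_re, Complex.one_re, Complex.ofReal_re]
    at hA hB h2 h3 ⊢
  rw [← hss]
  nlinarith [mul_nonneg (sq_nonneg s) h2, mul_nonneg (sq_nonneg s) h3]

/-- Positivity of the partial transpose bounds the coherence of `T` between `|ii⟩` and `|jj⟩` by its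
diagonal entries at `|ij⟩` and `|ji⟩`. Hence `T` cannot reject `|ij⟩`, `|ji⟩` and `w = |ii⟩ - |jj⟩`
all at once while it accepts `φ`. Equality of the two coefficients makes `w` orthogonal to `φ`. -/
theorem le_minimaxError_PPT (h0 : ∀ i, 0 ≤ lam i) (h1 : ∑ i, lam i = 1) {i j : ι} (hij : i ≠ j)
    (hl : lam i = lam j) {θ : ℝ} (hθ0 : 0 ≤ θ) :
    ENNReal.ofReal (lam i / 8) ≤ minimaxError .PPT (pureState (schmidtVector lam)) θ := by
  set φ := schmidtVector lam with hφ
  have hn : star φ ⬝ᵥ φ = 1 := schmidtVector_dotProduct_self h0 h1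
  set w : ι × ι → ℂ := ((1 : ℝ) : ℂ) • Pi.single (i, i) 1 + ((-1 : ℝ) : ℂ) • Pi.single (j, j) 1
    with hw
  have hφw : star φ ⬝ᵥ w = 0 := by
    rw [star_schmidtVector]
    simp [hw, schmidtVector, hl, dotProduct_add]
  have hww : star w ⬝ᵥ w = 2 := by
    simp only [hw, star_add, star_smul, ← Pi.single_star]
    simp [dotProduct_add, hij, hij.symm]
    norm_num
  -- The weight `1/4` normalises the trace, since `w` has squared norm `2`.
  refine le_minimaxError fun T hT => ⟨((1 / 4 : ℝ) : ℂ) • (pureState (Pi.single (i, j) 1) +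
    pureState (Pi.single (j, i) 1) + pureState w), ⟨⟨?_, ?_⟩, ?_⟩, ?_⟩
  · refine .smul (((pureState_posSemidef _).add (pureState_posSemidef _)).add
      (pureState_posSemidef _)) ?_
    rw [Complex.zero_le_real]; norm_num
  · simp only [trace_smul, trace_add, trace_pureState, hww, ← Pi.single_star]
    simp
    norm_num
  · simp only [mul_smul_comm, mul_add, trace_smul, trace_add, trace_mul_pureState,
      dotProduct_pureState_mulVec, hφw]
    have hz : φ (i, j) = 0 := by simp [hφ, schmidtVector, hij]
    have hz' : φ (j, i) = 0 := by simp [hφ, schmidtVector, hij.symm]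
    simpa [hz, hz'] using hθ0
  · have hp := PosSemidef.two_mul_re_entry_le hT.2.1 (i, j) (j, i)
    simp only [partialTranspose, of_apply] at hp
    have hi := IsEffect.half_schmidt_le h0 h1 hT.1 i
    have hj := IsEffect.half_schmidt_le h0 h1 hT.1 j
    have hε := PosSemidef.re_quadraticForm_nonneg hT.1.2 φ
    simp only [mul_smul_comm, mul_add, trace_smul, trace_add, trace_mul_pureState, smul_eq_mul,
      star_single_dotProduct_mulVec_single, Complex.add_re, Complex.re_ofReal_mul]
    rw [hw, IsHermitian.re_quadraticForm_add hT.1.1.isHermitian]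
    simp only [star_single_dotProduct_mulVec_single]
    rw [← hl] at hj
    linarith

end SchmidtVector

/-! ### The one-way test built from random signs. -/

section SignTest

variable {ι : Type} [Fintype ι] [DecidableEq ι]

/-- A sign vector, with complex entries. -/
def signVector (s : ι → ℤˣ) : ι → ℂ := fun i => ((s i : ℤ) : ℂ)

/-- Flipping the sign at `a` permutes the sign vectors and negates every summand. -/
theorem sum_sign_eq_zero {χ : (ι → ℤˣ) → ℤˣ} (a : ι)
    (hχ : ∀ s, χ (s * Pi.mulSingle a (-1)) = - χ s) : ∑ s, ((χ s : ℤ) : ℂ) = 0 := by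
  have h := Equiv.sum_comp (Equiv.mulRight (Pi.mulSingle a (-1) : ι → ℤˣ))
    (fun s => ((χ s : ℤ) : ℂ))
  simp only [Equiv.coe_mulRight, hχ, Units.val_neg, Int.cast_neg, Finset.sum_neg_distrib] at h
  exact self_eq_neg.mp h.symm

/-- Fourth moments of independent uniformly distributed signs. -/
theorem sum_sign_mul (i k j l : ι) :
    ∑ s : ι → ℤˣ, ((s i * s k * (s j * s l) : ℤˣ) : ℂ) =
      if (i = k ∧ j = l) ∨ (i = j ∧ k = l) ∨ (i = l ∧ k = j) then
        (Fintype.card (ι → ℤˣ) : ℂ) else 0 := by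
  split_ifs with h
  · have : ∀ s : ι → ℤˣ, s i * s k * (s j * s l) = 1 := by
      intro s
      have hs : ∀ a, s a * s a = 1 := fun a => Int.units_mul_self _
      rcases h with ⟨rfl, rfl⟩ | ⟨rfl, rfl⟩ | ⟨rfl, rfl⟩
      · simp [hs]
      · exact Int.units_mul_self _
      · rw [mul_comm (s k)]; exact Int.units_mul_self _
    simp [this]
  -- Unless the four indices pair up, some index occurs an odd number of times; flipping its sign
  -- negates the product.
  · have key : ∃ a, ((if i = a then (-1 : ℤˣ) else 1) * (if k = a then -1 else 1) *
        ((if j = a then -1 else 1) * (if l = a then -1 else 1))) = -1 := by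
      by_cases hik : i = k
      · exact ⟨j, by simp_all [eq_comm]⟩
      · by_cases hij : i = j
        · exact ⟨k, by simp_all [eq_comm]⟩
        · by_cases hil : i = l
          · exact ⟨k, by simp_all [eq_comm]⟩
          · exact ⟨i, by simp_all [eq_comm]⟩
    obtain ⟨a, ha⟩ := key
    refine sum_sign_eq_zero (χ := fun s => s i * s k * (s j * s l)) a fun s => ?_
    have hm : ∀ b, (Pi.mulSingle a (-1 : ℤˣ) : ι → ℤˣ) b = if b = a then -1 else 1 := fun b => by
      simp [Pi.mulSingle_apply]
    simp only [Pi.mul_apply, hm]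
    calc _ = ((if i = a then (-1 : ℤˣ) else 1) * (if k = a then -1 else 1) *
        ((if j = a then -1 else 1) * (if l = a then -1 else 1))) *
          (s i * s k * (s j * s l)) := by ac_rfl
      _ = _ := by rw [ha, neg_one_mul]

/-- Alice measures in a random sign basis, Bob projects onto the corresponding conditional
state of `schmidtVector lam`. -/
noncomputable def signTest (lam : ι → ℝ) : Matrix (ι × ι) (ι × ι) ℂ :=
  ∑ s : ι → ℤˣ, ((Fintype.card (ι → ℤˣ) : ℂ)⁻¹ • pureState (signVector s)) ⊗ₖ
    pureState (signVector s * fun i => (Real.sqrt (lam i) : ℂ))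

variable {lam : ι → ℝ}

theorem signVector_mul {ι : Type} (s : ι → ℤˣ) (i j : ι) :
    signVector s i * star (signVector s j) = ((s i * s j : ℤˣ) : ℂ) := by
  simp [signVector]

theorem mem_LOCC1_signTest (h0 : ∀ i, 0 ≤ lam i) (h1 : ∑ i, lam i = 1) :
    MeasClass.LOCC1.Mem (signTest lam) := by
  let eqv := (Fintype.equivFin (ι → ℤˣ)).symm
  refine ⟨Fintype.card (ι → ℤˣ), fun x => (Fintype.card (ι → ℤˣ) : ℂ)⁻¹ •
    pureState (signVector (eqv x)),
    fun x => pureState (signVector (eqv x) * fun i => (Real.sqrt (lam i) : ℂ)),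
    fun x => (pureState_posSemidef _).smul (by positivity), ?_, fun x => isEffect_pureState ?_, ?_⟩
  · rw [eqv.sum_comp fun s => (Fintype.card (ι → ℤˣ) : ℂ)⁻¹ • pureState (signVector s),
      ← Finset.smul_sum]
    ext i j
    have h := sum_sign_mul i j i i
    simp only [Int.units_mul_self, mul_one] at h
    simp only [Matrix.smul_apply, Matrix.sum_apply, pureState, vecMulVec_apply, Pi.star_apply,
      signVector_mul, h, one_apply]
    by_cases hij : i = j <;> simp [hij]
    grind
  · have hs : ∀ i, signVector (eqv x) i * signVector (eqv x) i = 1 := fun i => by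
      have := signVector_mul (eqv x) i i
      simpa [signVector, Int.units_mul_self] using this
    have : ∀ i, star ((signVector (eqv x) * fun i => (Real.sqrt (lam i) : ℂ)) i) *
        (signVector (eqv x) * fun i => (Real.sqrt (lam i) : ℂ)) i = lam i := fun i => by
      have hst : star (signVector (eqv x) i) = signVector (eqv x) i := by simp [signVector]
      rw [Pi.mul_apply, star_mul', hst, mul_mul_mul_comm, hs, one_mul, RCLike.star_def,
        Complex.conj_ofReal, sqrt_mul_sqrt_complex (h0 i)]
    simp only [dotProduct, Pi.star_apply, this]
    exact_mod_cast h1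
  · exact (eqv.sum_comp fun s => ((Fintype.card (ι → ℤˣ) : ℂ)⁻¹ • pureState (signVector s)) ⊗ₖ
      pureState (signVector s * fun i => (Real.sqrt (lam i) : ℂ))).symm

/-- The three pairings in the fourth moment give the projector onto `φ`, a diagonal term and a swap
term. All three overlap where every index agrees; that case is counted in the projector, so the
other two terms vanish on `p.1 = p.2`. -/
theorem signTest_apply (p q : ι × ι) :
    signTest lam p q = schmidtVector lam p * star (schmidtVector lam q) +
      ((if p = q then (if p.1 = p.2 then 0 else
          (Real.sqrt (lam p.2) : ℂ) * Real.sqrt (lam p.2)) else 0) +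
        (if p.swap = q then (if p.1 = p.2 then 0 else
          (Real.sqrt (lam p.2) : ℂ) * Real.sqrt (lam p.1)) else 0)) := by
  obtain ⟨i, k⟩ := p
  obtain ⟨j, l⟩ := q
  have h : signTest lam (i, k) (j, l) = (Fintype.card (ι → ℤˣ) : ℂ)⁻¹ *
      (∑ s : ι → ℤˣ, ((s i * s k * (s j * s l) : ℤˣ) : ℂ)) *
      ((Real.sqrt (lam k) : ℂ) * Real.sqrt (lam l)) := by
    simp only [signTest, Matrix.sum_apply, kroneckerMap_apply, Matrix.smul_apply, pureState,
      vecMulVec_apply, Finset.mul_sum, Finset.sum_mul]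
    refine Finset.sum_congr rfl fun s _ => ?_
    simp [signVector]
    ring
  have hc : (Fintype.card (ι → ℤˣ) : ℂ) ≠ 0 := by simp
  rw [h, sum_sign_mul]
  simp only [schmidtVector, Prod.mk.injEq, Prod.swap_prod_mk]
  by_cases hik : i = k
  · by_cases hjl : j = l
    · simp [hik, hjl]
    · have : ¬ ((i = k ∧ j = l) ∨ (i = j ∧ k = l) ∨ (i = l ∧ k = j)) := by grind
      simp [hik, hjl]
      grind
  · by_cases h1 : i = j ∧ k = l
    · obtain ⟨rfl, rfl⟩ := h1
      simp [hik, Ne.symm hik]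
    · by_cases h2 : i = l ∧ k = j
      · obtain ⟨rfl, rfl⟩ := h2
        simp [hik, Ne.symm hik]
      · have h3 : ¬ (k = j ∧ i = l) := by grind
        simp [hik, h1, h2, h3]

theorem trace_signTest_mul (σ : Matrix (ι × ι) (ι × ι) ℂ) :
    (signTest lam * σ).trace = (pureState (schmidtVector lam) * σ).trace +
      ∑ p : ι × ι, (if p.1 = p.2 then 0 else
        ((Real.sqrt (lam p.2) : ℂ) * Real.sqrt (lam p.2) * σ p p +
          (Real.sqrt (lam p.2) : ℂ) * Real.sqrt (lam p.1) * σ p.swap p)) := by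
  simp only [trace, diag_apply, mul_apply, signTest_apply, pureState, vecMulVec_apply, add_mul,
    Finset.sum_add_distrib, Pi.star_apply, ite_mul, zero_mul, Finset.sum_ite_eq, Finset.mem_univ,
    if_true]
  congr 1
  rw [← Finset.sum_add_distrib]
  refine Finset.sum_congr rfl fun p _ => ?_
  split_ifs <;> simp

theorem minimaxError_LOCC1_le (h0 : ∀ i, 0 ≤ lam i) (h1 : ∑ i, lam i = 1) {L : ℝ}
    (hL : ∀ i, lam i ≤ L) (θ : ℝ) :
    minimaxError .LOCC1 (pureState (schmidtVector lam)) θ ≤ ENNReal.ofReal ((θ + 2 * L) / 2) := by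
  set φ := schmidtVector lam with hφ
  have hn : star φ ⬝ᵥ φ = 1 := schmidtVector_dotProduct_self h0 h1
  refine minimaxError_le (mem_LOCC1_signTest h0 h1) fun σ hσ hθ => ?_
  -- The test never rejects `φ`: its correction terms live on `|ik⟩` with `i ≠ k`, where `φ`
  -- vanishes.
  have hacc : ((1 - signTest lam) * pureState φ).trace = 0 := by
    rw [sub_mul, trace_sub, one_mul, trace_signTest_mul, trace_mul_pureState,
      dotProduct_pureState_mulVec, trace_pureState, hn, Finset.sum_eq_zero]
    · simp
    · rintro ⟨i, j⟩ -
      by_cases hij : i = j <;> simp [hij, pureState, vecMulVec_apply, hφ, schmidtVector]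
  -- The diagonal and swap terms cost at most `L` each, the latter by bounding an off-diagonal entry
  -- of `σ` by the mean of two diagonal ones.
  have hsum : ∀ p : ι × ι, (if p.1 = p.2 then (0 : ℂ) else
        ((Real.sqrt (lam p.2) : ℂ) * Real.sqrt (lam p.2) * σ p p +
          (Real.sqrt (lam p.2) : ℂ) * Real.sqrt (lam p.1) * σ p.swap p)).re ≤
      L * (σ p p).re + L * (((σ p p).re + (σ p.swap p.swap).re) / 2) := fun p => by
    have hp := (Complex.le_def.mp (hσ.1.diag_nonneg (i := p))).1
    have hp' := (Complex.le_def.mp (hσ.1.diag_nonneg (i := p.swap))).1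
    simp only [Complex.zero_re] at hp hp'
    have hL0 : 0 ≤ L := (h0 p.1).trans (hL p.1)
    split_ifs
    · simp only [Complex.zero_re]; positivity
    · have hs := PosSemidef.two_mul_re_entry_le hσ.1 p.swap p
      rw [sqrt_mul_sqrt_complex (h0 _), ← Complex.ofReal_mul, Complex.add_re,
        Complex.re_ofReal_mul, Complex.re_ofReal_mul]
      have hc0 : 0 ≤ Real.sqrt (lam p.2) * Real.sqrt (lam p.1) := by positivity
      have hcL : Real.sqrt (lam p.2) * Real.sqrt (lam p.1) ≤ L := by
        rw [← Real.mul_self_sqrt hL0]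
        gcongr <;> exact hL _
      have e1 := mul_le_mul_of_nonneg_right (hL p.2) hp
      have e2 : Real.sqrt (lam p.2) * Real.sqrt (lam p.1) * (σ p.swap p).re ≤
          L * (((σ p p).re + (σ p.swap p.swap).re) / 2) :=
        (mul_le_mul_of_nonneg_left (by linarith) hc0).trans
          (mul_le_mul_of_nonneg_right hcL (by positivity))
      linarith
  have htr : ∑ p, (σ p p).re = 1 := by
    have := congrArg Complex.re hσ.2
    simpa [trace] using this
  have htr' : ∑ p : ι × ι, (σ p.swap p.swap).re = 1 := by
    rw [← htr]
    exact (Equiv.prodComm ι ι).sum_comp fun p => (σ p p).re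
  have := Finset.sum_le_sum fun p (_ : p ∈ Finset.univ) => hsum p
  rw [Finset.sum_add_distrib, ← Finset.mul_sum, ← Finset.mul_sum, ← Finset.sum_div,
    Finset.sum_add_distrib, htr, htr'] at this
  rw [trace_add, hacc, zero_add, trace_signTest_mul, Complex.add_re, Complex.re_sum]
  linarith

end SignTest

/-! ### Tensor powers and transfer of the bounds to `ρ^{⊗n}`. -/

section TensorPower

variable {d : ℕ}

theorem tensorPower_pureState {α β : Type} (ψ : α × β → ℂ) (n : ℕ) :
    tensorPower (pureState ψ) n =
      pureState fun p : (Fin n → α) × (Fin n → β) => ∏ k, ψ (p.1 k, p.2 k) := by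
  ext p q
  simp [tensorPower, pureState, vecMulVec_apply, Finset.prod_mul_distrib]

/-- The matrix `U^{⊗ n}`. -/
def matrixPower (U : Matrix (Fin d) (Fin d) ℂ) (n : ℕ) :
    Matrix (Fin n → Fin d) (Fin n → Fin d) ℂ :=
  Matrix.of fun a I => ∏ k, U (a k) (I k)

theorem matrixPower_unitary {U : Matrix (Fin d) (Fin d) ℂ} (hU : Uᴴ * U = 1) (n : ℕ) :
    (matrixPower U n)ᴴ * matrixPower U n = 1 := by
  ext I J
  have h : ∀ i j, ∑ a, star (U a i) * U a j = if i = j then 1 else 0 := fun i j => by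
    have := congrFun (congrFun hU i) j
    simpa [mul_apply, one_apply] using this
  simp only [mul_apply, conjTranspose_apply, matrixPower, of_apply, star_prod,
    ← Finset.prod_mul_distrib]
  rw [← Fintype.prod_sum fun k a => star (U a (I k)) * U a (J k)]
  simp only [h, one_apply, funext_iff]
  by_cases hIJ : ∀ k, I k = J k
  · simp [hIJ]
  · rw [if_neg hIJ]
    push Not at hIJ
    obtain ⟨k, hk⟩ := hIJ
    exact Finset.prod_eq_zero (Finset.mem_univ k) (if_neg hk)

/-- The matrix whose columns are the vectors of an orthonormal basis. -/
noncomputable def basisMatrix (e : OrthonormalBasis (Fin d) ℂ (EuclideanSpace ℂ (Fin d))) :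
    Matrix (Fin d) (Fin d) ℂ :=
  Matrix.of fun a i => e i a

theorem basisMatrix_unitary (e : OrthonormalBasis (Fin d) ℂ (EuclideanSpace ℂ (Fin d))) :
    (basisMatrix e)ᴴ * basisMatrix e = 1 := by
  ext i j
  have h := orthonormal_iff_ite.mp e.orthonormal i j
  rw [PiLp.inner_apply] at h
  simp only [RCLike.inner_apply] at h
  simp only [mul_apply, conjTranspose_apply, basisMatrix, of_apply, one_apply]
  rw [← h]
  exact Finset.sum_congr rfl fun a _ => mul_comm _ _

/-- The product coefficients `∏ k, lam (I k)`. -/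
def powerCoeff (lam : Fin d → ℝ) (n : ℕ) : (Fin n → Fin d) → ℝ := fun I => ∏ k, lam (I k)

variable {lam : Fin d → ℝ}

theorem powerCoeff_nonneg (h0 : ∀ i, 0 ≤ lam i) (n : ℕ) (I : Fin n → Fin d) :
    0 ≤ powerCoeff lam n I := Finset.prod_nonneg fun _ _ => h0 _

theorem sum_powerCoeff (h1 : ∑ i, lam i = 1) (n : ℕ) : ∑ I, powerCoeff lam n I = 1 := by
  simp only [powerCoeff]
  rw [← Fintype.prod_sum fun _ i => lam i, h1]
  simp

theorem powerCoeff_le (h0 : ∀ i, 0 ≤ lam i) {L : ℝ} (hL : ∀ i, lam i ≤ L) (n : ℕ)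
    (I : Fin n → Fin d) : powerCoeff lam n I ≤ L ^ n := by
  simpa [powerCoeff] using Finset.prod_le_prod (s := Finset.univ) (f := fun k => lam (I k)) (g := fun _ => L)
    (fun _ _ => h0 _) (fun _ _ => hL _)

theorem sqrt_powerCoeff (h0 : ∀ i, 0 ≤ lam i) (n : ℕ) (I : Fin n → Fin d) :
    Real.sqrt (powerCoeff lam n I) = ∏ k, Real.sqrt (lam (I k)) :=
  Real.sqrt_prod _ fun _ _ => h0 _

variable {ψ : Fin d × Fin d → ℂ} {e f : OrthonormalBasis (Fin d) ℂ (EuclideanSpace ℂ (Fin d))}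

/-- A local unitary takes the standard Schmidt vector to `ψ^{⊗ n}`. -/
theorem IsSchmidtDecomposition.tensorPower_eq (h : IsSchmidtDecomposition ψ lam e f) (n : ℕ) :
    tensorPower (pureState ψ) n =
      (matrixPower (basisMatrix e) n ⊗ₖ matrixPower (basisMatrix f) n) *
        pureState (schmidtVector (powerCoeff lam n)) *
        (matrixPower (basisMatrix e) n ⊗ₖ matrixPower (basisMatrix f) n)ᴴ := by
  rw [tensorPower_pureState, ← pureState_mulVec]
  congr 1
  ext ⟨a, b⟩
  simp only [h.eq_sum, mulVec, dotProduct, Fintype.sum_prod_type, kroneckerMap_apply,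
    schmidtVector, mul_ite, mul_zero, Finset.sum_ite_eq, Finset.mem_univ, if_true]
  rw [Fintype.prod_sum fun k i => (Real.sqrt (lam i) : ℂ) * (e i (a k) * f i (b k))]
  refine Finset.sum_congr rfl fun I _ => ?_
  rw [sqrt_powerCoeff h.nonneg]
  simp only [matrixPower, basisMatrix, of_apply, Finset.prod_mul_distrib]
  push_cast
  ring

theorem IsSchmidtDecomposition.sum_eq_one (h : IsSchmidtDecomposition ψ lam e f)
    (hψ : ∑ p, ‖ψ p‖ ^ 2 = 1) : ∑ i, lam i = 1 := by
  have hv : ψ = (basisMatrix e ⊗ₖ basisMatrix f) *ᵥ schmidtVector lam := by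
    ext ⟨a, b⟩
    simp only [h.eq_sum, mulVec, dotProduct, Fintype.sum_prod_type, kroneckerMap_apply,
      schmidtVector, mul_ite, mul_zero, Finset.sum_ite_eq, Finset.mem_univ, if_true]
    exact Finset.sum_congr rfl fun i _ => mul_comm _ _
  have h1 : star ψ ⬝ᵥ ψ = 1 := by
    have : ∀ p, star (ψ p) * ψ p = ((‖ψ p‖ ^ 2 : ℝ) : ℂ) := fun p => by
      rw [RCLike.star_def, Complex.conj_mul']; push_cast; rfl
    simp only [dotProduct, Pi.star_apply, this]
    exact_mod_cast hψ
  rw [hv, star_mulVec, ← dotProduct_mulVec, mulVec_mulVec,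
    kronecker_conjTranspose_mul_self (basisMatrix_unitary e) (basisMatrix_unitary f),
    one_mulVec, star_schmidtVector] at h1
  simp only [schmidtVector, dotProduct, Fintype.sum_prod_type, ite_mul, zero_mul, mul_ite,
    mul_zero, Finset.sum_ite_eq, Finset.mem_univ, if_true, sqrt_mul_sqrt_complex (h.nonneg _)]
    at h1
  exact_mod_cast h1

theorem IsSchmidtDecomposition.exists_pos [NeZero d] (h : IsSchmidtDecomposition ψ lam e f)
    (hent : IsEntangled ψ) : ∃ i, i ≠ 0 ∧ 0 < lam i := by
  by_contra hcon
  push Not at hcon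
  refine hent ⟨fun a => (Real.sqrt (lam 0) : ℂ) * e 0 a, fun b => f 0 b, fun p => ?_⟩
  rw [h.eq_sum, Finset.sum_eq_single 0]
  · ring
  · intro i _ hi
    simp [Real.sqrt_eq_zero_of_nonpos (hcon i hi)]
  · simp

theorem IsSchmidtDecomposition.le_zero [NeZero d] (h : IsSchmidtDecomposition ψ lam e f)
    (i : Fin d) : lam i ≤ lam 0 := h.antitone (Fin.zero_le i)

theorem IsSchmidtDecomposition.minimaxError_le (h : IsSchmidtDecomposition ψ lam e f)
    {X : MeasClass} {n : ℕ} {θ : ℝ}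
    (hX : ∀ U V : Matrix (Fin n → Fin d) (Fin n → Fin d) ℂ, Uᴴ * U = 1 → Vᴴ * V = 1 →
      ∀ T, X.Mem T → X.Mem ((U ⊗ₖ V) * T * (U ⊗ₖ V)ᴴ)) :
    minimaxError X (tensorPower (pureState ψ) n) θ ≤
      minimaxError X (pureState (schmidtVector (powerCoeff lam n))) θ := by
  have hU := matrixPower_unitary (basisMatrix_unitary e) n
  have hV := matrixPower_unitary (basisMatrix_unitary f) n
  rw [h.tensorPower_eq]
  exact minimaxError_conj_le (kronecker_conjTranspose_mul_self hU hV) (hX _ _ hU hV) _ _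

theorem IsSchmidtDecomposition.le_minimaxError (h : IsSchmidtDecomposition ψ lam e f)
    {X : MeasClass} {n : ℕ} {θ : ℝ}
    (hX : ∀ U V : Matrix (Fin n → Fin d) (Fin n → Fin d) ℂ, Uᴴ * U = 1 → Vᴴ * V = 1 →
      ∀ T, X.Mem T → X.Mem ((U ⊗ₖ V) * T * (U ⊗ₖ V)ᴴ)) :
    minimaxError X (pureState (schmidtVector (powerCoeff lam n))) θ ≤
      minimaxError X (tensorPower (pureState ψ) n) θ := by
  have hU := matrixPower_unitary (basisMatrix_unitary e) n
  have hV := matrixPower_unitary (basisMatrix_unitary f) n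
  have hW := kronecker_conjTranspose_mul_self hU hV
  have hU' : (matrixPower (basisMatrix e) n)ᴴᴴ * (matrixPower (basisMatrix e) n)ᴴ = 1 := by
    rw [conjTranspose_conjTranspose, mul_eq_one_comm.mp hU]
  have hV' : (matrixPower (basisMatrix f) n)ᴴᴴ * (matrixPower (basisMatrix f) n)ᴴ = 1 := by
    rw [conjTranspose_conjTranspose, mul_eq_one_comm.mp hV]
  have := minimaxError_conj_le (kronecker_conjTranspose_mul_self hU' hV') (hX _ _ hU' hV')
    (tensorPower (pureState ψ) n) θ
  rw [← conjTranspose_kronecker, conjTranspose_conjTranspose] at this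
  convert this using 1
  rw [h.tensorPower_eq]
  set W := matrixPower (basisMatrix e) n ⊗ₖ matrixPower (basisMatrix f) n
  set R := pureState (schmidtVector (powerCoeff lam n))
  congr 1
  calc R = (Wᴴ * W) * R * (Wᴴ * W) := by rw [hW, one_mul, mul_one]
    _ = _ := by simp only [mul_assoc]

theorem mem_ALL_conj {n : ℕ} (U V : Matrix (Fin n → Fin d) (Fin n → Fin d) ℂ) (hU : Uᴴ * U = 1)
    (hV : Vᴴ * V = 1) (T : Matrix ((Fin n → Fin d) × (Fin n → Fin d)) _ ℂ)
    (hT : MeasClass.ALL.Mem T) : MeasClass.ALL.Mem ((U ⊗ₖ V) * T * (U ⊗ₖ V)ᴴ) :=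
  isEffect_conj (kronecker_conjTranspose_mul_self hU hV) hT

theorem minimaxError_tensorPower_ALL [NeZero d] (h : IsSchmidtDecomposition ψ lam e f)
    (hψ : ∑ p, ‖ψ p‖ ^ 2 = 1) (hent : IsEntangled ψ) {n : ℕ} (hn : n ≠ 0) {θ : ℝ} (hθ0 : 0 ≤ θ)
    (hθ1 : θ ≤ 1) :
    minimaxError .ALL (tensorPower (pureState ψ) n) θ = ENNReal.ofReal (θ / 2) := by
  have h0 := powerCoeff_nonneg h.nonneg n
  have h1 := sum_powerCoeff (h.sum_eq_one hψ) n
  obtain ⟨i, hi, -⟩ := h.exists_pos hent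
  have : NeZero n := ⟨hn⟩
  have hij : (fun _ => i : Fin n → Fin d) ≠ fun _ => 0 := fun hc => hi (congrFun hc 0)
  exact le_antisymm ((h.minimaxError_le mem_ALL_conj).trans (minimaxError_ALL_le h0 h1 θ))
    ((le_minimaxError_ALL h0 h1 hij hθ0 hθ1).trans (h.le_minimaxError mem_ALL_conj))

theorem minimaxError_tensorPower_LOCC1_le [NeZero d] (h : IsSchmidtDecomposition ψ lam e f)
    (hψ : ∑ p, ‖ψ p‖ ^ 2 = 1) (n : ℕ) (θ : ℝ) :
    minimaxError .LOCC1 (tensorPower (pureState ψ) n) θ ≤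
      ENNReal.ofReal ((θ + 2 * lam 0 ^ n) / 2) :=
  (h.minimaxError_le fun _ _ hU hV _ => mem_LOCC1_conj hU hV).trans
    (minimaxError_LOCC1_le (powerCoeff_nonneg h.nonneg n) (sum_powerCoeff (h.sum_eq_one hψ) n)
      (powerCoeff_le h.nonneg h.le_zero n) θ)

theorem le_minimaxError_tensorPower_PPT [NeZero d] (h : IsSchmidtDecomposition ψ lam e f)
    (hψ : ∑ p, ‖ψ p‖ ^ 2 = 1) {i : Fin d} (hi : i ≠ 0) {n : ℕ} (hn : 2 ≤ n) {θ : ℝ}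
    (hθ0 : 0 ≤ θ) :
    ENNReal.ofReal (lam i * lam 0 ^ (n - 1) / 8) ≤
      minimaxError .PPT (tensorPower (pureState ψ) n) θ := by
  obtain ⟨m, rfl⟩ := Nat.exists_eq_add_of_le' hn
  -- The index `i` sits in the first copy for `I` and in the second for `J`; this needs two copies
  -- and makes the product coefficients equal.
  let I : Fin (m + 2) → Fin d := Fin.cons i (Fin.cons 0 fun _ => 0)
  let J : Fin (m + 2) → Fin d := Fin.cons 0 (Fin.cons i fun _ => 0)
  have hIJ : I ≠ J := fun hc => hi (congrFun hc 0)
  have hI : powerCoeff lam (m + 2) I = lam i * lam 0 ^ (m + 1) := by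
    simp [powerCoeff, I, Fin.prod_univ_succ, pow_succ']
  have hJ : powerCoeff lam (m + 2) J = lam i * lam 0 ^ (m + 1) := by
    simp [powerCoeff, J, Fin.prod_univ_succ, pow_succ']
    ring
  have := le_minimaxError_PPT (powerCoeff_nonneg h.nonneg (m + 2))
    (sum_powerCoeff (h.sum_eq_one hψ) (m + 2)) hIJ (hI.trans hJ.symm) hθ0
  rw [hI] at this
  exact this.trans (h.le_minimaxError fun _ _ hU hV _ => mem_PPT_conj hU hV)

end TensorPower

/-! ### Passage to exponential rates. -/

section Rates

theorem tendsto_log_const_mul_pow_div {a c : ℝ} (ha : 0 < a) (hc : 0 < c) :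
    Tendsto (fun n : ℕ => -(ENNReal.log (ENNReal.ofReal (a * c ^ n)) / (n : EReal))) atTop
      (𝓝 ((-Real.log c : ℝ) : EReal)) := by
  have h : Tendsto (fun n : ℕ => -(Real.log a / n + Real.log c)) atTop (𝓝 (-Real.log c)) := by
    have := ((tendsto_const_div_atTop_nhds_zero_nat (Real.log a)).add_const (Real.log c)).neg
    simpa using this
  refine (EReal.tendsto_coe.mpr h).congr' ?_
  filter_upwards [eventually_ge_atTop 1] with n hn
  have hn0 : (n : ℝ) ≠ 0 := by positivity
  rw [ENNReal.log_ofReal_of_pos (by positivity), Real.log_mul ha.ne' (by positivity),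
    Real.log_pow, ← EReal.coe_natCast, ← EReal.coe_div, ← EReal.coe_neg]
  congr 2
  field_simp

theorem tendsto_exponent {P : ℕ → ℝ≥0∞} {a b c : ℝ} (ha : 0 < a) (hb : 0 < b) (hc : 0 < c)
    (hlow : ∀ᶠ n in atTop, ENNReal.ofReal (a * c ^ n) ≤ P n)
    (hupp : ∀ᶠ n in atTop, P n ≤ ENNReal.ofReal (b * c ^ n)) :
    Tendsto (fun n : ℕ => -(ENNReal.log (P n) / (n : EReal))) atTop
      (𝓝 ((-Real.log c : ℝ) : EReal)) := by
  refine tendsto_of_tendsto_of_tendsto_of_le_of_le' (tendsto_log_const_mul_pow_div hb hc)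
    (tendsto_log_const_mul_pow_div ha hc) ?_ ?_
  · filter_upwards [hupp] with n hn
    exact EReal.neg_le_neg_iff.mpr (EReal.div_le_div_right_of_nonneg (Nat.cast_nonneg' n)
      (ENNReal.log_le_log hn))
  · filter_upwards [hlow] with n hn
    exact EReal.neg_le_neg_iff.mpr (EReal.div_le_div_right_of_nonneg (Nat.cast_nonneg' n)
      (ENNReal.log_le_log hn))

variable {d : ℕ} [NeZero d] {lam : Fin d → ℝ} {ψ : Fin d × Fin d → ℂ}
  {e f : OrthonormalBasis (Fin d) ℂ (EuclideanSpace ℂ (Fin d))} {θ : ℝ}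

theorem tendsto_errorExponent_ALL (h : IsSchmidtDecomposition ψ lam e f)
    (hψ : ∑ p, ‖ψ p‖ ^ 2 = 1) (hent : IsEntangled ψ) (hθ0 : 0 < θ) (hθ1 : θ ≤ 1) :
    Tendsto (errorExponent .ALL (pureState ψ) θ) atTop (𝓝 ((-Real.log θ : ℝ) : EReal)) := by
  have hP : ∀ᶠ n : ℕ in atTop, minimaxError .ALL (tensorPower (pureState ψ) n) (θ ^ n) =
      ENNReal.ofReal (1 / 2 * θ ^ n) := by
    filter_upwards [eventually_ne_atTop 0] with n hn
    rw [minimaxError_tensorPower_ALL h hψ hent hn (by positivity) (pow_le_one₀ hθ0.le hθ1)]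
    congr 1; ring
  exact tendsto_exponent one_half_pos one_half_pos hθ0 (hP.mono fun n hn => hn.ge)
    (hP.mono fun n hn => hn.le)

/-- As `Real.log 0 = 0`, the value `+∞` at `θ = 0` is not covered by the real formula; here the
error is exactly `0` for `n ≥ 1`. -/
theorem tendsto_errorExponent_ALL_zero (h : IsSchmidtDecomposition ψ lam e f)
    (hψ : ∑ p, ‖ψ p‖ ^ 2 = 1) (hent : IsEntangled ψ) :
    Tendsto (errorExponent .ALL (pureState ψ) 0) atTop (𝓝 ⊤) := by
  refine tendsto_const_nhds.congr' ?_
  filter_upwards [eventually_ne_atTop 0] with n hn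
  rw [errorExponent, zero_pow hn, minimaxError_tensorPower_ALL h hψ hent hn le_rfl zero_le_one]
  rw [zero_div, ENNReal.ofReal_zero, ENNReal.log_zero, EReal.bot_div_of_pos_ne_top, EReal.neg_bot]
  · exact_mod_cast Nat.pos_of_ne_zero hn
  · exact EReal.natCast_ne_top n

theorem tendsto_errorExponent_local (h : IsSchmidtDecomposition ψ lam e f)
    (hψ : ∑ p, ‖ψ p‖ ^ 2 = 1) (hent : IsEntangled ψ) (hθ0 : 0 ≤ θ) (hθ1 : θ ≤ 1) {X : MeasClass}
    (hX : ∀ n ρ t, minimaxError (α := Fin n → Fin d) (β := Fin n → Fin d) X ρ t ≤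
      minimaxError .LOCC1 ρ t)
    (hX' : ∀ n ρ t, minimaxError (α := Fin n → Fin d) (β := Fin n → Fin d) .PPT ρ t ≤
      minimaxError X ρ t) :
    Tendsto (errorExponent X (pureState ψ) θ) atTop
      (𝓝 ((-Real.log (max θ (lam 0)) : ℝ) : EReal)) := by
  obtain ⟨i, hi, hpos⟩ := h.exists_pos hent
  have hl0 : 0 < lam 0 := hpos.trans_le (h.le_zero i)
  have hc : 0 < max θ (lam 0) := lt_max_of_lt_right hl0
  -- The two entries of `a` are the prefactors of the `ALL` bound (for `θ ≥ λ`) and of the `PPT`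
  -- bound (for `θ ≤ λ`), where `λ_i λ^(n-1) = (λ_i/λ) λ^n`. The value `3/2` comes from `(θ^n +
  -- 2λ^n)/2`.
  refine tendsto_exponent (a := min (1 / 2) (lam i / lam 0 / 8)) (b := 3 / 2)
    (lt_min (by norm_num) (by positivity)) (by norm_num) hc ?_ (.of_forall fun n => ?_)
  · filter_upwards [eventually_ge_atTop 2] with n hn
    refine le_trans ?_ (hX' n _ _)
    rcases le_total θ (lam 0) with hθ | hθ
    · refine le_trans (ENNReal.ofReal_le_ofReal ?_)
        (le_minimaxError_tensorPower_PPT h hψ hi hn (pow_nonneg hθ0 n))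
      rw [max_eq_right hθ]
      calc _ ≤ lam i / lam 0 / 8 * lam 0 ^ n := by gcongr; exact min_le_right _ _
        _ = _ := by
          obtain ⟨m, rfl⟩ := Nat.exists_eq_add_of_le' hn
          rw [show m + 2 - 1 = m + 1 from rfl, pow_succ _ (m + 1)]
          field_simp
    · refine le_trans (ENNReal.ofReal_le_ofReal ?_)
        ((minimaxError_tensorPower_ALL h hψ hent (by omega) (pow_nonneg hθ0 n)
          (pow_le_one₀ hθ0 hθ1)).ge.trans (minimaxError_anti (fun _ => mem_ALL_of_PPT) _ _))
      rw [max_eq_left hθ]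
      calc _ ≤ 1 / 2 * θ ^ n := by gcongr; exact min_le_left _ _
        _ = _ := by ring
  · refine ((hX n _ _).trans (minimaxError_tensorPower_LOCC1_le h hψ n _)).trans
      (ENNReal.ofReal_le_ofReal ?_)
    have e1 : θ ^ n ≤ max θ (lam 0) ^ n := pow_le_pow_left₀ hθ0 (le_max_left _ _) n
    have e2 : lam 0 ^ n ≤ max θ (lam 0) ^ n := pow_le_pow_left₀ hl0.le (le_max_right _ _) n
    linarith

end Rates

end PureStateTest

/-! ### Assembly of the theorem. -/

open PureStateTest in
theorem theorem4 (d : ℕ) [NeZero d] (ψ : Fin d × Fin d → ℂ) (hψ : ∑ p, ‖ψ p‖ ^ 2 = 1)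
    (hent : IsEntangled ψ) (lam : Fin d → ℝ)
    (e f : OrthonormalBasis (Fin d) ℂ (EuclideanSpace ℂ (Fin d)))
    (hschmidt : IsSchmidtDecomposition ψ lam e f)
    (θ : ℝ) (hθ0 : 0 ≤ θ) (hθ1 : θ ≤ 1) :
    -- all the limits exist
    (∀ X : MeasClass, Tendsto (errorExponent X (pureState ψ) θ) atTop
      (𝓝 (rate X (pureState ψ) θ))) ∧
    rate .LOCC1 (pureState ψ) θ = rate .LOCC (pureState ψ) θ ∧
    rate .LOCC (pureState ψ) θ = rate .SEP (pureState ψ) θ ∧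
    rate .SEP (pureState ψ) θ = rate .PPT (pureState ψ) θ ∧
    rate .PPT (pureState ψ) θ = ((-Real.log (max θ (lam 0)) : ℝ) : EReal) ∧
    (lam 0 ≤ θ →
      rate .LOCC1 (pureState ψ) θ = ((-Real.log θ : ℝ) : EReal) ∧
      rate .ALL (pureState ψ) θ = ((-Real.log θ : ℝ) : EReal)) ∧
    (θ < lam 0 → lam 0 < 1 →
      rate .PPT (pureState ψ) θ < rate .ALL (pureState ψ) θ) ∧
    (θ < 1 / (d : ℝ) →
      rate .PPT (pureState ψ) θ < rate .ALL (pureState ψ) θ ∧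
      rate .LOCC (pureState ψ) θ < rate .ALL (pureState ψ) θ) := by
  have h12 : ∀ n ρ t, minimaxError (α := Fin n → Fin d) (β := Fin n → Fin d) .LOCC ρ t ≤
      minimaxError .LOCC1 ρ t := fun _ => minimaxError_anti fun _ => mem_LOCC_of_LOCC1
  have h23 : ∀ n ρ t, minimaxError (α := Fin n → Fin d) (β := Fin n → Fin d) .SEP ρ t ≤
      minimaxError .LOCC ρ t := fun _ => minimaxError_anti fun _ => mem_SEP_of_LOCC
  have h34 : ∀ n ρ t, minimaxError (α := Fin n → Fin d) (β := Fin n → Fin d) .PPT ρ t ≤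
      minimaxError .SEP ρ t := fun _ => minimaxError_anti fun _ => mem_PPT_of_SEP
  have t1 := tendsto_errorExponent_local hschmidt hψ hent hθ0 hθ1 (X := .LOCC1)
    (fun _ _ _ => le_rfl) fun n ρ t => (h34 n ρ t).trans ((h23 n ρ t).trans (h12 n ρ t))
  have t2 := tendsto_errorExponent_local hschmidt hψ hent hθ0 hθ1 (X := .LOCC)
    h12 fun n ρ t => (h34 n ρ t).trans (h23 n ρ t)
  have t3 := tendsto_errorExponent_local hschmidt hψ hent hθ0 hθ1 (X := .SEP)
    (fun n ρ t => (h23 n ρ t).trans (h12 n ρ t)) h34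
  have t4 := tendsto_errorExponent_local hschmidt hψ hent hθ0 hθ1 (X := .PPT)
    (fun n ρ t => (h34 n ρ t).trans ((h23 n ρ t).trans (h12 n ρ t))) fun _ _ _ => le_rfl
  have r1 : rate .LOCC1 (pureState ψ) θ = _ := t1.limUnder_eq
  have r2 : rate .LOCC (pureState ψ) θ = _ := t2.limUnder_eq
  have r3 : rate .SEP (pureState ψ) θ = _ := t3.limUnder_eq
  have r4 : rate .PPT (pureState ψ) θ = _ := t4.limUnder_eq
  have t5 : Tendsto (errorExponent .ALL (pureState ψ) θ) atTop
      (𝓝 (rate .ALL (pureState ψ) θ)) := by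
    rcases hθ0.eq_or_lt with rfl | hθ
    · exact tendsto_nhds_limUnder ⟨_, tendsto_errorExponent_ALL_zero hschmidt hψ hent⟩
    · exact tendsto_nhds_limUnder ⟨_, tendsto_errorExponent_ALL hschmidt hψ hent hθ hθ1⟩
  have r5 : 0 < θ → rate .ALL (pureState ψ) θ = ((-Real.log θ : ℝ) : EReal) := fun hθ =>
    (tendsto_errorExponent_ALL hschmidt hψ hent hθ hθ1).limUnder_eq
  obtain ⟨i, hi, hpos⟩ := hschmidt.exists_pos hent
  have hl0 : 0 < lam 0 := hpos.trans_le (hschmidt.le_zero i)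
  have hlt : θ < lam 0 → rate .PPT (pureState ψ) θ < rate .ALL (pureState ψ) θ := by
    intro hθl
    rw [r4, max_eq_right hθl.le]
    rcases hθ0.eq_or_lt with rfl | hθ
    · rw [show rate .ALL (pureState ψ) 0 = ⊤ from
        (tendsto_errorExponent_ALL_zero hschmidt hψ hent).limUnder_eq]
      exact EReal.coe_lt_top _
    · rw [r5 hθ, EReal.coe_lt_coe_iff]
      exact neg_lt_neg (Real.log_lt_log hθ hθl)
  -- The largest of `d` coefficients summing to one is at least their mean, so `θ < 1/d` falls under
  -- `hlt`.
  have hd : 1 / (d : ℝ) ≤ lam 0 := by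
    have hd0 : (0 : ℝ) < d := by exact_mod_cast NeZero.pos d
    rw [div_le_iff₀' hd0, ← hschmidt.sum_eq_one hψ]
    simpa using Finset.sum_le_sum fun i (_ : i ∈ Finset.univ) => hschmidt.le_zero i
  refine ⟨?_, r1.trans r2.symm, r2.trans r3.symm, r3.trans r4.symm, r4, fun hle => ?_,
    fun hθ _ => hlt hθ, fun hθ => ?_⟩
  · rintro (_ | _ | _ | _ | _)
    exacts [r1 ▸ t1, r2 ▸ t2, r3 ▸ t3, r4 ▸ t4, t5]
  · exact ⟨by rw [r1, max_eq_left hle], r5 (hl0.trans_le hle)⟩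
  · have := hlt (hθ.trans_le hd)
    exact ⟨this, by rwa [r2, ← r4]⟩
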